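/- Let $m \ge 1$ be an integer and let $n$ be an even integer with $n \ge 2^m$. Let $Q_n$ be the $n$-dimensional hypercube graph: its vertices are the binary $n$-tuples, and two vertices are adjacent if and only if they differ in exactly one coordinate. Then $Q_n$ can be decomposed into cycles of length $2^m n$; that is, there is a finite collection of pairwise edge-disjoint subgraphs of $Q_n$, each of which is a cycle with exactly $2^m n$ edges, such that every edge of $Q_n$ belongs to exactly one of these subgraphs. -/

import Mathlib

/-- The graph of the `n`-cube: vertices are the binary `n`-tuples, and two of them are adjacent
when they differ in exactly one coordinate. -/
def hypercubeGraph (n : ℕ) : SimpleGraph (Fin n → Bool) where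
  Adj u v := ∃! i : Fin n, u i ≠ v i
  symm := ⟨fun _ _ h => by simpa only [ne_comm] using h⟩
  loopless := ⟨fun _ h => h.exists.elim fun _ hi => hi rfl⟩

/-- The subgraphs `D i` of `G` form a decomposition of `G`: they are pairwise edge-disjoint and
every edge of `G` belongs to exactly one of them. -/
def IsGraphDecomposition {V ι : Type*} (G : SimpleGraph V) (D : ι → G.Subgraph) : Prop :=
  (∀ i j : ι, i ≠ j → Disjoint (D i).edgeSet (D j).edgeSet) ∧
    ∀ e ∈ G.edgeSet, ∃! i : ι, e ∈ (D i).edgeSet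

/-- `H` decomposes `G`: there is a finite decomposition of `G` all of whose members are
isomorphic to `H`. -/
def GraphDecomposes {W V : Type*} (H : SimpleGraph W) (G : SimpleGraph V) : Prop :=
  ∃ (r : ℕ) (D : Fin r → G.Subgraph),
    IsGraphDecomposition G D ∧ ∀ i : Fin r, Nonempty ((D i).coe ≃g H)

open SimpleGraph

/-! The proof inducts on the dimension, with `Q_{n+2}` viewed as `Q_n □ C_4`. The invariant is a
cover of the edges by cycles of length `ℓ`, together with an assignment of each vertex to one cycle
through it, so that every cycle owns `s` vertices.

Lift a cycle to the product by following it and making one step `±1` in `C_4` above each vertex it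
owns. The signs decide the total rise. With rise `0` the lift closes after one turn, and its four
rotations give cycles of length `ℓ + s` (`liftsTo_id`). With rise `2` it closes after two turns, and
two rotations give cycles of length `2 * (ℓ + s)` (`liftsTo_parity`). The rotations cover all lifts
of the edges of the cycle and all vertical edges above its own vertices. The new cycles own `s` and
`2 * s` vertices respectively, so the step can be repeated.

From the 4-cycle `Q_2` with `ℓ = s = 4`, these two moves reach `ℓ = 2 ^ m * n` and `s = 2 ^ (m +
1)`. Disjointness is not carried along: `2 * ℓ = n * s` makes the total length of the cycles equal
to the number of edges, so the cover is a decomposition. -/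

/-! ### Lifting paths and cycles to the product with a 4-cycle -/

/-- The rotation of the second factor of `G □ cycleGraph 4` by `j`. -/
def boxCycleShift {V : Type*} (G : SimpleGraph V) (j : Fin 4) :
    (G □ cycleGraph 4) →g (G □ cycleGraph 4) where
  toFun x := (x.1, x.2 + j)
  map_rel' := by
    rintro ⟨a, c⟩ ⟨b, d⟩ h
    have key : ∀ c d j : Fin 4, (cycleGraph 4).Adj c d → (cycleGraph 4).Adj (c + j) (d + j) := by
      decide
    rcases boxProd_adj.1 h with ⟨h1, h2⟩ | ⟨h1, h2⟩
    · exact boxProd_adj.2 (Or.inl ⟨h1, congrArg (· + j) h2⟩)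
    · exact boxProd_adj.2 (Or.inr ⟨key _ _ _ h1, h2⟩)

@[simp] theorem boxCycleShift_apply {V : Type*} (G : SimpleGraph V) (j : Fin 4) (x : V × Fin 4) :
    boxCycleShift G j x = (x.1, x.2 + j) := rfl

theorem boxCycleShift_injective {V : Type*} (G : SimpleGraph V) (j : Fin 4) :
    Function.Injective (boxCycleShift G j) := by
  rintro ⟨a, c⟩ ⟨b, d⟩ h
  simpa using h

/-- Closing a path of length at least two by an edge gives a cycle. -/
theorem SimpleGraph.Walk.IsPath.cons_isCycle {V : Type*} {G : SimpleGraph V} {x y : V}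
    {p : G.Walk y x} (hp : p.IsPath) (h : G.Adj x y) (hl : 2 ≤ p.length) :
    (Walk.cons h p).IsCycle := by
  rw [Walk.cons_isCycle_iff]
  refine ⟨hp, fun he => ?_⟩
  cases p with
  | nil => simp at hl
  | @cons _ z _ h' p' =>
    rw [Walk.cons_isPath_iff] at hp
    rw [Walk.edges_cons, List.mem_cons] at he
    rcases he with he | he
    · have : z = x := by
        rcases Sym2.eq_iff.1 he with ⟨h1, h2⟩ | ⟨h1, h2⟩
        · exact absurd h2 h'.ne
        · exact h1.symm
      subst this
      have := Walk.length_eq_zero_iff.2 (Walk.isPath_iff_nil.1 hp.1)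
      rw [Walk.length_cons] at hl
      omega
    · exact hp.2 (Walk.snd_mem_support_of_mem_edges _ he)

/-- A path of `G` lifts to a path of `G □ cycleGraph 4` whose second coordinate moves by `ε w`
above each vertex `w` of the path. -/
theorem exists_lift_path {V : Type*} [DecidableEq V] {G : SimpleGraph V} (ε : V → Fin 4)
    (hε : ∀ w, ε w = 0 ∨ ε w = 1 ∨ ε w = 3) {u v : V} (p : G.Walk u v) :
    p.IsPath → ∀ a : Fin 4, ∃ (θ : V → Fin 4) (b : Fin 4) (q : (G □ cycleGraph 4).Walk (u, a) (v, b)),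
      b = a + (p.support.map ε).sum ∧ q.IsPath ∧
      q.length = p.length + p.support.countP (fun w => ε w ≠ 0) ∧
      (∀ x ∈ q.support, x.1 ∈ p.support ∧ (x.2 = θ x.1 ∨ x.2 = θ x.1 + ε x.1)) ∧
      (∀ x y, s(x, y) ∈ p.edges → ∃ c, s((x, c), (y, c)) ∈ q.edges) ∧
      (∀ w ∈ p.support, ε w ≠ 0 → s((w, θ w), (w, θ w + ε w)) ∈ q.edges) := by
  have hadj : ∀ (a e : Fin 4), (e = 0 ∨ e = 1 ∨ e = 3) → e ≠ 0 → (cycleGraph 4).Adj a (a + e) := by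
    decide
  have hne : ∀ (a e : Fin 4), e ≠ 0 → a ≠ a + e := by decide
  induction p with
  | nil =>
    rename_i u
    intro _ a
    by_cases h0 : ε u = 0
    · exact ⟨fun _ => a, a, Walk.nil, by simp [h0], by simp, by simp [h0], by simp, by simp,
        by simp [h0]⟩
    · refine ⟨fun _ => a, a + ε u, Walk.cons
        (boxProd_adj_right.2 (hadj a _ (hε u) h0)) Walk.nil, by simp, ?_, by simp [h0], ?_,
        by simp, by simp⟩
      · simp [Walk.cons_isPath_iff, h0]
      · simp
  | cons h p ih =>
    rename_i u u' v
    intro hp a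
    rw [Walk.cons_isPath_iff] at hp
    -- The vertical step above `u` precedes the edge to `u'`, so the rest is lifted from height `a +
    -- ε u`; `θ u` becomes the entry height `a`.
    obtain ⟨θ, b, q, hb, hq, hl, hs, he, hv⟩ := ih hp.1 (a + ε u)
    have hu : ∀ c, (u, c) ∉ q.support := fun c hc => hp.2 (hs _ hc).1
    have hθ : ∀ w ∈ p.support, Function.update θ u a w = θ w := fun w hw =>
      Function.update_of_ne (by rintro rfl; exact hp.2 hw) _ _
    have hstep : (G □ cycleGraph 4).Adj (u, a + ε u) (u', a + ε u) := boxProd_adj_left.2 h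
    have hs' : ∀ x ∈ q.support, x.1 ∈ u :: p.support ∧
        (x.2 = Function.update θ u a x.1 ∨ x.2 = Function.update θ u a x.1 + ε x.1) := by
      intro x hx
      rw [hθ _ (hs x hx).1]
      exact ⟨List.mem_cons_of_mem _ (hs x hx).1, (hs x hx).2⟩
    have hv' : ∀ w ∈ p.support, ε w ≠ 0 →
        s((w, Function.update θ u a w), (w, Function.update θ u a w + ε w)) ∈ q.edges := by
      intro w hw hw0
      rw [hθ w hw]
      exact hv w hw hw0
    have he' : ∀ x y, s(x, y) ∈ s(u, u') :: p.edges →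
        ∃ c, s((x, c), (y, c)) = s((u, a + ε u), (u', a + ε u)) ∨ s((x, c), (y, c)) ∈ q.edges := by
      intro x y hxy
      rcases List.mem_cons.1 hxy with hxy | hxy
      · refine ⟨a + ε u, Or.inl ?_⟩
        rcases Sym2.eq_iff.1 hxy with ⟨rfl, rfl⟩ | ⟨rfl, rfl⟩
        · rfl
        · exact Sym2.eq_swap
      · obtain ⟨c, hc⟩ := he x y hxy
        exact ⟨c, Or.inr hc⟩
    by_cases h0 : ε u = 0
    · have e0 : a + ε u = a := by rw [h0, add_zero]
      have hstep' : (G □ cycleGraph 4).Adj (u, a) (u', a + ε u) := by simpa [e0] using hstep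
      refine ⟨Function.update θ u a, b, Walk.cons hstep' q, ?_, ?_, ?_, ?_, ?_, ?_⟩
      · simp [hb, add_assoc]
      · exact (Walk.cons_isPath_iff _ _).2 ⟨hq, hu _⟩
      · simp [hl, h0]; omega
      · intro x hx
        rw [Walk.support_cons, List.mem_cons] at hx
        rcases hx with rfl | hx
        · simp
        · simpa using hs' x hx
      · intro x y hxy
        obtain ⟨c, hc⟩ := he' x y (by simpa using hxy)
        refine ⟨c, ?_⟩
        rw [Walk.edges_cons, List.mem_cons]
        simpa [e0] using hc
      · intro w hw hw0
        rw [Walk.support_cons, List.mem_cons] at hw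
        rcases hw with rfl | hw
        · exact absurd h0 hw0
        · rw [Walk.edges_cons]
          exact List.mem_cons_of_mem _ (hv' w hw hw0)
    · have hup : (G □ cycleGraph 4).Adj (u, a) (u, a + ε u) :=
        boxProd_adj_right.2 (hadj a _ (hε u) h0)
      refine ⟨Function.update θ u a, b, Walk.cons hup (Walk.cons hstep q), ?_, ?_, ?_, ?_, ?_, ?_⟩
      · simp [hb, add_assoc]
      · refine (Walk.cons_isPath_iff _ _).2 ⟨(Walk.cons_isPath_iff _ _).2 ⟨hq, hu _⟩, ?_⟩
        rw [Walk.support_cons, List.mem_cons, not_or]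
        exact ⟨fun e => hne a _ h0 (congrArg Prod.snd e), hu _⟩
      · simp [hl, h0]; omega
      · intro x hx
        rw [Walk.support_cons, Walk.support_cons, List.mem_cons, List.mem_cons] at hx
        rcases hx with rfl | rfl | hx
        · simp
        · simp
        · simpa using hs' x hx
      · intro x y hxy
        obtain ⟨c, hc⟩ := he' x y (by simpa using hxy)
        refine ⟨c, ?_⟩
        rw [Walk.edges_cons, Walk.edges_cons, List.mem_cons, List.mem_cons]
        exact Or.inr hc
      · intro w hw hw0
        rw [Walk.support_cons, List.mem_cons] at hw
        rw [Walk.edges_cons, Walk.edges_cons]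
        rcases hw with rfl | hw
        · simp
        · exact List.mem_cons_of_mem _ (List.mem_cons_of_mem _ (hv' w hw hw0))

/-- On a nonempty set of even size one can choose values `±1` in `Fin 4` with any even sum. -/
theorem exists_signs_sum_eq {V : Type*} [DecidableEq V] (D : Finset V) (hD : Even D.card)
    (hne : D.Nonempty) (σ : Fin 4) (hσ : σ = 0 ∨ σ = 2) :
    ∃ ε : V → Fin 4, (∀ w, ε w = 0 ∨ ε w = 1 ∨ ε w = 3) ∧ (∀ w, ε w ≠ 0 ↔ w ∈ D) ∧
      ∑ w ∈ D, ε w = σ := by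
  obtain ⟨v, hv⟩ := hne
  -- All of `D` but one vertex `v` gets the sign `1`. These are an odd number of steps, so a last
  -- step `±1` above `v` can reach either even residue.
  have hodd : ((D.erase v).card • (1 : Fin 4) = 1) ∨ ((D.erase v).card • (1 : Fin 4) = 3) := by
    obtain ⟨r, hr⟩ := hD
    have h4 : (4 : ℕ) • (1 : Fin 4) = 0 := by decide
    have hc := Finset.card_erase_add_one hv
    obtain ⟨k, hk | hk⟩ : ∃ k, (D.erase v).card = k * 4 + 1 ∨ (D.erase v).card = k * 4 + 3 :=
      ⟨(D.erase v).card / 4, by omega⟩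
    · left; rw [hk, add_nsmul, mul_nsmul', h4, smul_zero, zero_add, one_nsmul]
    · right; rw [hk, add_nsmul, mul_nsmul', h4, smul_zero]; decide
  obtain ⟨z, hz, hzσ⟩ : ∃ z : Fin 4, (z = 1 ∨ z = 3) ∧ z + (D.erase v).card • (1 : Fin 4) = σ := by
    rcases hodd with h | h <;> rw [h] <;> rcases hσ with rfl | rfl <;> decide
  have hz0 : z ≠ 0 := by rcases hz with rfl | rfl <;> decide
  refine ⟨fun w => if w = v then z else if w ∈ D then 1 else 0, fun w => ?_, fun w => ?_, ?_⟩
  · dsimp only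
    split_ifs
    · exact Or.inr hz
    · simp
    · simp
  · dsimp only
    split_ifs with h1 h2
    · subst h1; simp [hz0, hv]
    · simp [h2]
    · simp [h2]
  · rw [← Finset.add_sum_erase _ _ hv, ← hzσ, ← Finset.sum_const]
    congr 1
    · simp
    · refine Finset.sum_congr rfl fun w hw => ?_
      rw [if_neg (Finset.ne_of_mem_erase hw), if_pos (Finset.mem_of_mem_erase hw)]

/-- A cycle of `G`, cut open at its base point, lifts to a path of `G □ cycleGraph 4` which moves
by one step in the second coordinate above each vertex of `D`. -/
theorem exists_lift_cycle {V : Type*} [DecidableEq V] {G : SimpleGraph V} {x : V} (c : G.Walk x x)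
    (hc : c.IsCycle) (D : Finset V) (hDc : ∀ w ∈ D, w ∈ c.support) (hD : Even D.card)
    (hne : D.Nonempty) (σ : Fin 4) (hσ : σ = 0 ∨ σ = 2) :
    ∃ (y : V) (_ : G.Adj x y) (θ ε : V → Fin 4) (q : (G □ cycleGraph 4).Walk (y, 0) (x, σ)),
      q.IsPath ∧ 2 ≤ q.length ∧ q.length + 1 = c.length + D.card ∧
      (∀ w, ε w = 0 ∨ ε w = 1 ∨ ε w = 3) ∧
      (∀ z ∈ q.support, z.2 = θ z.1 ∨ z.2 = θ z.1 + ε z.1) ∧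
      (∀ w ∈ D, (ε w = 1 ∨ ε w = 3) ∧ s((w, θ w), (w, θ w + ε w)) ∈ q.edges) ∧
      (∀ a b, s(a, b) ∈ c.edges → s(a, b) = s(x, y) ∨ ∃ i, s((a, i), (b, i)) ∈ q.edges) := by
  obtain ⟨ε, hε, hεD, hsum⟩ := exists_signs_sum_eq D hD hne σ hσ
  have hl := hc.three_le_length
  cases c with
  | nil => simp at hl
  | cons h p =>
    rename_i y
    -- Without its first edge, the cycle is a path meeting each of its vertices exactly once, the
    -- base point last.
    have hp : p.IsPath := ((Walk.cons_isCycle_iff _ _).1 hc).1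
    have hDp : ∀ w ∈ D, w ∈ p.support := by
      intro w hw
      have := hDc w hw
      rw [Walk.support_cons, List.mem_cons] at this
      rcases this with rfl | h'
      · exact p.end_mem_support
      · exact h'
    have hfil : p.support.toFinset.filter (fun w => ε w ≠ 0) = D := by
      ext w
      simp only [Finset.mem_filter, List.mem_toFinset, hεD]
      exact ⟨fun h => h.2, fun h => ⟨hDp w h, h⟩⟩
    have hcount : p.support.countP (fun w => ε w ≠ 0) = D.card := by
      rw [← hfil, List.countP_eq_length_filter,
        ← List.toFinset_card_of_nodup (hp.support_nodup.filter _)]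
      congr 1
      ext w
      simp
    have hs : (p.support.map ε).sum = σ := by
      rw [← List.sum_toFinset _ hp.support_nodup, ← hsum, ← hfil, Finset.sum_filter_ne_zero]
    obtain ⟨θ, b, q, hb, hq, hql, hqs, hqe, hqv⟩ := exists_lift_path ε hε p hp 0
    rw [hs, zero_add] at hb
    subst hb
    rw [hcount] at hql
    rw [Walk.length_cons] at hl
    refine ⟨y, h, θ, ε, q, hq, by omega, by rw [Walk.length_cons]; omega, hε,
      fun z hz => (hqs z hz).2, fun w hw => ⟨?_, hqv w (hDp w hw) ((hεD w).2 hw)⟩, ?_⟩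
    · exact (hε w).resolve_left ((hεD w).2 hw)
    · intro a b' hab
      rw [Walk.edges_cons, List.mem_cons] at hab
      exact hab.imp id (hqe a b')

/-! ### Rotating the lifted cycles -/

/-- There are cycles `K j` of length `ℓ` of `G □ cycleGraph 4` over the edges `E` and the vertices `D`
of `G` such that the four lifts of an edge in `E`, and the four edges above a vertex in `D`,
are distributed among them according to `g`. -/
def LiftsTo {V J : Type*} (G : SimpleGraph V) (g : Fin 4 → J) (E : List (Sym2 V)) (D : Finset V)
    (ℓ : ℕ) : Prop :=
  ∃ (θ : V → Fin 4) (r : J → V × Fin 4) (K : ∀ j, (G □ cycleGraph 4).Walk (r j) (r j)),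
    (∀ j, (K j).IsCycle ∧ (K j).length = ℓ) ∧
    (∀ v ∈ D, ∃ e : Fin 4, (e = 1 ∨ e = 3) ∧
      ∀ i, s((v, θ v + i), (v, θ v + e + i)) ∈ (K (g i)).edges) ∧
    (∀ a b, s(a, b) ∈ E → ∃ k : Fin 4, ∀ i, s((a, k + i), (b, k + i)) ∈ (K (g i)).edges)

theorem mem_edges_map_boxCycleShift {V : Type*} {G : SimpleGraph V} {x y : V × Fin 4}
    {q : (G □ cycleGraph 4).Walk x y} {a b : V} {i k : Fin 4} (h : s((a, i), (b, k)) ∈ q.edges)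
    (j : Fin 4) :
    s((a, i + j), (b, k + j)) ∈ (q.map (boxCycleShift G j)).edges := by
  rw [Walk.edges_map]
  exact List.mem_map.2 ⟨_, h, rfl⟩

theorem liftsTo_id {V : Type*} [DecidableEq V] {G : SimpleGraph V} {x : V} (c : G.Walk x x)
    (hc : c.IsCycle) (D : Finset V) (hDc : ∀ w ∈ D, w ∈ c.support) (hD : Even D.card)
    (hne : D.Nonempty) : LiftsTo G (id : Fin 4 → Fin 4) c.edges D (c.length + D.card) := by
  obtain ⟨y, h, θ, ε, q, hq, h2, hl, hε, hs, hv, he⟩ :=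
    exists_lift_cycle c hc D hDc hD hne 0 (Or.inl rfl)
  have h' : (G □ cycleGraph 4).Adj (x, 0) (y, 0) := boxProd_adj_left.2 h
  refine ⟨θ, _, fun j => (Walk.cons h' q).map (boxCycleShift G j), fun j => ⟨?_, ?_⟩,
    fun v hvD => ⟨ε v, (hv v hvD).1, fun i => ?_⟩, fun a b hab => ?_⟩
  · exact (hq.cons_isCycle h' h2).map (boxCycleShift_injective G j)
  · rw [Walk.length_map, Walk.length_cons, hl]
  · refine mem_edges_map_boxCycleShift ?_ i
    rw [Walk.edges_cons]
    exact List.mem_cons_of_mem _ (hv v hvD).2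
  · obtain hab | ⟨k, hk⟩ := he a b hab
    · refine ⟨0, fun i => mem_edges_map_boxCycleShift ?_ i⟩
      rw [Walk.edges_cons]
      refine List.mem_cons.2 (Or.inl ?_)
      rcases Sym2.eq_iff.1 hab with ⟨rfl, rfl⟩ | ⟨rfl, rfl⟩
      · rfl
      · exact Sym2.eq_swap
    · refine ⟨k, fun i => mem_edges_map_boxCycleShift ?_ i⟩
      rw [Walk.edges_cons]
      exact List.mem_cons_of_mem _ hk

/-- Reduction of the positions modulo two. -/
def finFourParity (i : Fin 4) : Bool := i = 1 ∨ i = 3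

/-- The lift with rise `2` is followed by its own rotation by `2`, which closes it up. The resulting
cycle already contains two opposite rotations, so only the rotations by `0` and `1` are needed. -/
theorem liftsTo_parity {V : Type*} [DecidableEq V] {G : SimpleGraph V} {x : V} (c : G.Walk x x)
    (hc : c.IsCycle) (D : Finset V) (hDc : ∀ w ∈ D, w ∈ c.support) (hD : Even D.card)
    (hne : D.Nonempty) : LiftsTo G finFourParity c.edges D (2 * (c.length + D.card)) := by
  obtain ⟨y, h, θ, ε, q, hq, h2, hl, hε, hs, hv, he⟩ :=
    exists_lift_cycle c hc D hDc hD hne 2 (Or.inr rfl)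
  have h' : (G □ cycleGraph 4).Adj (x, 0) (y, 0) := boxProd_adj_left.2 h
  have h'' : (G □ cycleGraph 4).Adj (x, 2) (y, 0 + 2) := boxProd_adj_left.2 h
  let q' : (G □ cycleGraph 4).Walk (y, 0 + 2) (x, 2 + 2) := q.map (boxCycleShift G 2)
  have hq' : q'.IsPath := hq.map (boxCycleShift_injective G 2)
  have hdisj : ∀ z ∈ q.support, z ∉ q'.support := by
    rintro ⟨w, i⟩ hz hz'
    replace hz' : (w, i) ∈ q.support.map (boxCycleShift G 2) := by
      rw [← Walk.support_map]; exact hz'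
    obtain ⟨⟨w', i'⟩, hw', heq⟩ := List.mem_map.1 hz'
    simp only [boxCycleShift_apply, Prod.mk.injEq] at heq
    obtain ⟨rfl, rfl⟩ := heq
    -- Above each vertex the lift occupies one height or two consecutive ones, so a rotation by `2`
    -- avoids it.
    have key : ∀ t e i : Fin 4, (e = 0 ∨ e = 1 ∨ e = 3) → (i = t ∨ i = t + e) →
        ¬ (i + 2 = t ∨ i + 2 = t + e) := by decide
    exact key _ _ _ (hε w') (hs _ hw') (hs _ hz)
  let P : (G □ cycleGraph 4).Walk (y, 0) (x, 2 + 2) := q.append (Walk.cons h'' q')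
  have hP : P.IsPath := by
    rw [Walk.isPath_def, Walk.support_append, Walk.support_cons, List.tail_cons]
    exact List.Nodup.append hq.support_nodup hq'.support_nodup (fun z hz hz' => hdisj z hz hz')
  have hPl : P.length = 2 * q.length + 1 := by
    have h1 : P.length = q.length + (q'.length + 1) := Walk.length_append _ _
    have h2 : q'.length = q.length := Walk.length_map _ _
    omega
  let B : (G □ cycleGraph 4).Walk (x, 0) (x, 2 + 2) := Walk.cons h' P
  have hB : (Walk.cons h' P : (G □ cycleGraph 4).Walk (x, 0) (x, 0)).IsCycle :=
    hP.cons_isCycle h' (by omega)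
  have hBq : ∀ e ∈ q.edges, e ∈ B.edges := by
    intro e h
    simp [B, P, h]
  have hBq' : ∀ e ∈ q'.edges, e ∈ B.edges := by
    intro e h
    simp [B, P, h]
  have hB0 : s((x, 0), (y, 0)) ∈ B.edges := by simp [B]
  have hB2 : s((x, 0 + 2), (y, 0 + 2)) ∈ B.edges := by
    have e : ((0 : Fin 4) + 2) = 2 := rfl
    simp [B, P, e]
  -- `2 + 2` reduces to `0` in `Fin 4`, so `B` is a closed walk.
  let C : (G □ cycleGraph 4).Walk (x, 0) (x, 0) := B
  let ρ : Bool → Fin 4 := fun b => if b then 1 else 0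
  have main : ∀ (a b : V) (i k : Fin 4), s((a, i), (b, k)) ∈ B.edges →
      s((a, i + 2), (b, k + 2)) ∈ B.edges → ∀ j,
      s((a, i + j), (b, k + j)) ∈ (C.map (boxCycleShift G (ρ (finFourParity j)))).edges := by
    intro a b i k h0 h2 j
    have key : ∀ j : Fin 4, j = ρ (finFourParity j) ∨ j = 2 + ρ (finFourParity j) := by decide
    rcases key j with hj | hj
    · have e : s((a, i + j), (b, k + j)) =
          s((a, i + ρ (finFourParity j)), (b, k + ρ (finFourParity j))) := by rw [← hj]
      rw [e]
      exact mem_edges_map_boxCycleShift (q := C) h0 _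
    · have e : s((a, i + j), (b, k + j)) =
          s((a, i + 2 + ρ (finFourParity j)), (b, k + 2 + ρ (finFourParity j))) := by
        rw [add_assoc, add_assoc, ← hj]
      rw [e]
      exact mem_edges_map_boxCycleShift (q := C) h2 _
  refine ⟨θ, _, fun j => C.map (boxCycleShift G (ρ j)), fun j => ⟨?_, ?_⟩,
    fun v hvD => ⟨ε v, (hv v hvD).1, main _ _ _ _ ?_ ?_⟩, fun a b hab => ?_⟩
  · exact hB.map (boxCycleShift_injective G _)
  · have : C.length = P.length + 1 := Walk.length_cons _ _
    rw [Walk.length_map, this, hPl, ← hl]; ring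
  · exact hBq _ (hv v hvD).2
  · exact hBq' _ (mem_edges_map_boxCycleShift (hv v hvD).2 2)
  · obtain hab | ⟨k, hk⟩ := he a b hab
    · refine ⟨0, main _ _ _ _ ?_ ?_⟩
      · rcases Sym2.eq_iff.1 hab with ⟨rfl, rfl⟩ | ⟨rfl, rfl⟩
        · exact hB0
        · rw [Sym2.eq_swap]; exact hB0
      · rcases Sym2.eq_iff.1 hab with ⟨rfl, rfl⟩ | ⟨rfl, rfl⟩
        · exact hB2
        · rw [Sym2.eq_swap]; exact hB2
    · exact ⟨k, main _ _ _ _ (hBq _ hk) (hBq' _ (mem_edges_map_boxCycleShift hk 2))⟩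

/-! ### Balanced covers and the inductive step -/

/-- `G` is covered by cycles of length `ℓ`, and its vertices are distributed among these cycles
such that each cycle receives `s` of its own vertices. -/
def HasBalancedCycleCover {V : Type*} [Fintype V] (G : SimpleGraph V) (ℓ s : ℕ) : Prop :=
  ∃ (T : Type) (_ : Fintype T) (_ : DecidableEq T) (x : T → V) (c : ∀ t, G.Walk (x t) (x t))
    (A : V → T), (∀ t, (c t).IsCycle ∧ (c t).length = ℓ) ∧ (∀ v, v ∈ (c (A v)).support) ∧
    (∀ e ∈ G.edgeSet, ∃ t, e ∈ (c t).edges) ∧ ∀ t, (Finset.univ.filter (A · = t)).card = s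

theorem HasBalancedCycleCover.map_iso {V W : Type*} [Fintype V] [Fintype W] {G : SimpleGraph V}
    {H : SimpleGraph W} (φ : G ≃g H) {ℓ s : ℕ} (h : HasBalancedCycleCover G ℓ s) :
    HasBalancedCycleCover H ℓ s := by
  obtain ⟨T, hT, hT', x, c, A, hc, hs, he, hA⟩ := h
  refine ⟨T, hT, hT', fun t => φ (x t), fun t => (c t).map φ.toHom, fun w => A (φ.symm w),
    fun t => ⟨(hc t).1.map φ.injective, by rw [Walk.length_map, (hc t).2]⟩, fun w => ?_, ?_,
    fun t => ?_⟩
  · rw [Walk.support_map]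
    exact List.mem_map.2 ⟨_, hs (φ.symm w), φ.apply_symm_apply w⟩
  · intro e
    induction e with
    | _ a b =>
      intro hab
      obtain ⟨t, ht⟩ := he s(φ.symm a, φ.symm b) (φ.symm.map_adj_iff.2 hab)
      refine ⟨t, ?_⟩
      rw [Walk.edges_map]
      refine List.mem_map.2 ⟨_, ht, ?_⟩
      exact congrArg₂ (fun a b => s(a, b)) (φ.apply_symm_apply a) (φ.apply_symm_apply b)
  · rw [← hA t]
    exact Finset.card_equiv φ.symm.toEquiv (by simp)

/-- Horizontal edges are covered because their projections are, vertical ones because every vertex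
has an owner whose lifts contain the whole fibre 4-cycle above it. -/
theorem HasBalancedCycleCover.boxProd_of_liftsTo {V : Type*} [Fintype V] [DecidableEq V]
    {G : SimpleGraph V} {ℓ s ℓ' k : ℕ} {J : Type} [Fintype J] [DecidableEq J] (g : Fin 4 → J)
    (hg : ∀ j, (Finset.univ.filter (g · = j)).card = k)
    (hlift : ∀ {x : V} (c : G.Walk x x), c.IsCycle → c.length = ℓ → ∀ D : Finset V,
      (∀ w ∈ D, w ∈ c.support) → D.card = s → LiftsTo G g c.edges D ℓ')
    (h : HasBalancedCycleCover G ℓ s) :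
    HasBalancedCycleCover (G □ cycleGraph 4) ℓ' (s * k) := by
  obtain ⟨T, hT, hT', x, c, A, hc, hs, he, hA⟩ := h
  have hK := fun t => hlift (c t) (hc t).1 (hc t).2 (Finset.univ.filter (A · = t))
    (by intro w hw; rw [← (Finset.mem_filter.1 hw).2]; exact hs w) (hA t)
  choose θ r K hKc hKv hKe using hK
  refine ⟨T × J, inferInstance, inferInstance, fun t => r t.1 t.2, fun t => K t.1 t.2,
    -- A vertex above `v` belongs to the rotation that carries the entry height `θ v` to its own
    -- height. Each rotation thus gets one vertex above each `v` owned by the old cycle, and each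
    -- new cycle unites `k` rotations.
    fun z => (A z.1, g (z.2 - θ (A z.1) z.1)), fun t => hKc t.1 t.2, ?_, ?_, ?_⟩
  · rintro ⟨v, i⟩
    obtain ⟨e, -, hi⟩ := hKv (A v) v (by simp)
    have := Walk.fst_mem_support_of_mem_edges _ (hi (i - θ (A v) v))
    simpa using this
  · intro e
    induction e with
    | _ a b =>
      obtain ⟨v, i⟩ := a
      obtain ⟨w, i'⟩ := b
      intro hab
      rcases boxProd_adj.1 hab with ⟨h1, h2⟩ | ⟨h1, h2⟩
      · dsimp only at h1 h2
        subst h2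
        obtain ⟨t, ht⟩ := he s(v, w) h1
        obtain ⟨m, hm⟩ := hKe t v w ht
        exact ⟨(t, g (i - m)), by simpa using hm (i - m)⟩
      · dsimp only at h1 h2
        subst h2
        obtain ⟨e, he, hi⟩ := hKv (A v) v (by simp)
        have key : ∀ i i' e : Fin 4, (cycleGraph 4).Adj i i' → (e = 1 ∨ e = 3) →
            i' = i + e ∨ i = i' + e := by decide
        rcases key i i' e h1 he with rfl | rfl
        · refine ⟨(A v, g (i - θ (A v) v)), ?_⟩
          have := hi (i - θ (A v) v)
          rwa [add_sub_cancel, add_right_comm, add_sub_cancel] at this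
        · refine ⟨(A v, g (i' - θ (A v) v)), ?_⟩
          have := hi (i' - θ (A v) v)
          rwa [add_sub_cancel, add_right_comm, add_sub_cancel, Sym2.eq_swap] at this
  · rintro ⟨t, j⟩
    rw [← hA t, ← hg j, ← Finset.card_product]
    refine Finset.card_bij (fun z _ => (z.1, z.2 - θ (A z.1) z.1)) ?_ ?_ ?_
    · rintro ⟨v, i⟩ h
      simpa using h
    · rintro ⟨v, i⟩ _ ⟨w, i'⟩ _ h
      simp only [Prod.mk.injEq] at h
      obtain ⟨rfl, h⟩ := h
      simpa using h
    · rintro ⟨v, i⟩ h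
      exact ⟨(v, i + θ (A v) v), by simpa using h, by simp⟩

theorem HasBalancedCycleCover.boxProd_same {V : Type*} [Fintype V] [DecidableEq V]
    {G : SimpleGraph V} {ℓ s : ℕ} (hs : Even s) (hs0 : s ≠ 0) (h : HasBalancedCycleCover G ℓ s) :
    HasBalancedCycleCover (G □ cycleGraph 4) (ℓ + s) s := by
  rw [← mul_one s]
  refine h.boxProd_of_liftsTo (id : Fin 4 → Fin 4) (by decide) ?_
  rintro x c hc rfl D hDc rfl
  rw [mul_one]
  exact liftsTo_id c hc D hDc hs (Finset.card_ne_zero.1 hs0)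

theorem HasBalancedCycleCover.boxProd_double {V : Type*} [Fintype V] [DecidableEq V]
    {G : SimpleGraph V} {ℓ s : ℕ} (hs : Even s) (hs0 : s ≠ 0) (h : HasBalancedCycleCover G ℓ s) :
    HasBalancedCycleCover (G □ cycleGraph 4) (2 * (ℓ + s)) (s * 2) := by
  refine h.boxProd_of_liftsTo finFourParity (by decide) ?_
  rintro x c hc rfl D hDc rfl
  exact liftsTo_parity c hc D hDc hs (Finset.card_ne_zero.1 hs0)

/-! ### Balanced covers of the cubes -/

theorem hasBalancedCycleCover_hypercubeGraph_two :
    HasBalancedCycleCover (hypercubeGraph 2) 4 4 := by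
  have h1 : (hypercubeGraph 2).Adj ![false, false] ![true, false] := by
    change ∃! i : Fin 2, _
    unfold ExistsUnique
    decide
  have h2 : (hypercubeGraph 2).Adj ![true, false] ![true, true] := by
    change ∃! i : Fin 2, _
    unfold ExistsUnique
    decide
  have h3 : (hypercubeGraph 2).Adj ![true, true] ![false, true] := by
    change ∃! i : Fin 2, _
    unfold ExistsUnique
    decide
  have h4 : (hypercubeGraph 2).Adj ![false, true] ![false, false] := by
    change ∃! i : Fin 2, _
    unfold ExistsUnique
    decide
  refine ⟨Unit, inferInstance, inferInstance, fun _ => ![false, false],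
    fun _ => .cons h1 (.cons h2 (.cons h3 (.cons h4 .nil))), fun _ => (), fun _ => ⟨?_, rfl⟩,
    ?_, ?_, fun _ => by simp⟩
  · refine Walk.IsPath.cons_isCycle ?_ _ (by simp)
    rw [Walk.isPath_def]
    simp only [Walk.support_cons, Walk.support_nil]
    decide
  · simp only [Walk.support_cons, Walk.support_nil]
    decide
  · intro e
    induction e with
    | _ a b =>
      intro hab
      replace hab : ∃! i : Fin 2, a i ≠ b i := hab
      refine ⟨(), ?_⟩
      simp only [Walk.edges_cons, Walk.edges_nil]
      clear h1 h2 h3 h4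
      unfold ExistsUnique at hab
      revert a b
      decide

theorem existsUnique_fin_succ {n : ℕ} (P : Fin (n + 1) → Prop) :
    (∃! i, P i) ↔ (P 0 ∧ ∀ i : Fin n, ¬ P i.succ) ∨ (¬ P 0 ∧ ∃! i : Fin n, P i.succ) := by
  constructor
  · rintro ⟨i, hi, hu⟩
    induction i using Fin.cases with
    | zero => exact Or.inl ⟨hi, fun j hj => Fin.succ_ne_zero j (hu _ hj)⟩
    | succ i =>
      exact Or.inr ⟨fun h0 => Fin.succ_ne_zero i (hu _ h0).symm,
        i, hi, fun j hj => Fin.succ_injective _ (hu _ hj)⟩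
  · rintro (⟨h0, h⟩ | ⟨h0, i, hi, hu⟩)
    · refine ⟨0, h0, fun j hj => ?_⟩
      induction j using Fin.cases with
      | zero => rfl
      | succ j => exact absurd hj (h j)
    · refine ⟨i.succ, hi, fun j hj => ?_⟩
      induction j using Fin.cases with
      | zero => exact absurd hj h0
      | succ j => rw [hu j hj]

/-- The Gray code identifying the `4`-cycle with the `2`-cube. -/
def grayCode : Bool × Bool ≃ Fin 4 where
  toFun b := if b.1 then (if b.2 then 2 else 1) else (if b.2 then 3 else 0)
  invFun i := (i = 1 ∨ i = 2, i = 2 ∨ i = 3)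
  left_inv := by unfold Function.LeftInverse; decide
  right_inv := by unfold Function.RightInverse Function.LeftInverse; decide

/-- The `(n + 2)`-cube is the box product of the `n`-cube and a `4`-cycle. -/
def hypercubeGraphAddTwoIso (n : ℕ) :
    hypercubeGraph (n + 2) ≃g hypercubeGraph n □ cycleGraph 4 where
  toFun u := (fun i => u i.succ.succ, grayCode (u 0, u 1))
  invFun z := Fin.cons (grayCode.symm z.2).1
    (Fin.cons (grayCode.symm z.2).2 z.1 : Fin (n + 1) → Bool)
  left_inv u := by
    funext i
    refine Fin.cases ?_ (fun i => Fin.cases ?_ (fun i => ?_) i) i <;> simp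
  right_inv z := Prod.ext rfl (grayCode.apply_symm_apply z.2)
  map_rel_iff' := by
    intro u v
    have key : ∀ a b c d : Bool, (cycleGraph 4).Adj (grayCode (a, b)) (grayCode (c, d)) ↔
        (a ≠ c ∧ b = d) ∨ (a = c ∧ b ≠ d) := by decide
    change _ ↔ ∃! i, u i ≠ v i
    rw [existsUnique_fin_succ, existsUnique_fin_succ, Fin.forall_fin_succ]
    have h1 : (Fin.succ 0 : Fin (n + 2)) = 1 := rfl
    rw [boxProd_adj]
    change ((∃! i : Fin n, u i.succ.succ ≠ v i.succ.succ) ∧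
      grayCode (u 0, u 1) = grayCode (v 0, v 1)) ∨
      ((cycleGraph 4).Adj (grayCode (u 0, u 1)) (grayCode (v 0, v 1)) ∧
        (fun i : Fin n => u i.succ.succ) = fun i => v i.succ.succ) ↔ _
    rw [key, grayCode.apply_eq_iff_eq, Prod.mk.injEq, funext_iff, h1]
    simp only [not_not]
    tauto

theorem hypercubeGraph_hasBalancedCycleCover_succ {n ℓ s : ℕ} (hs : Even s) (hs0 : s ≠ 0)
    (h : HasBalancedCycleCover (hypercubeGraph n) ℓ s) :
    HasBalancedCycleCover (hypercubeGraph (n + 2)) (ℓ + s) s ∧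
      HasBalancedCycleCover (hypercubeGraph (n + 2)) (2 * (ℓ + s)) (s * 2) :=
  ⟨(h.boxProd_same hs hs0).map_iso (hypercubeGraphAddTwoIso n).symm,
    (h.boxProd_double hs hs0).map_iso (hypercubeGraphAddTwoIso n).symm⟩

/-- Induction on `k` uses the move that keeps `s`, induction on `m` the one that doubles it. Each
raises the dimension by two. -/
theorem hasBalancedCycleCover_hypercubeGraph (m k : ℕ) :
    HasBalancedCycleCover (hypercubeGraph (2 * (k + m + 1)))
      (2 ^ (m + 1) * (2 * (k + m + 1))) (2 ^ (m + 2)) := by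
  induction m with
  | zero =>
    induction k with
    | zero => exact hasBalancedCycleCover_hypercubeGraph_two
    | succ k ih =>
      have e : 2 * (k + 1 + 0 + 1) = 2 * (k + 0 + 1) + 2 := by ring
      have e' : 2 ^ (0 + 1) * (2 * (k + 0 + 1) + 2) =
        2 ^ (0 + 1) * (2 * (k + 0 + 1)) + 2 ^ (0 + 2) := by ring
      rw [e, e']
      exact (hypercubeGraph_hasBalancedCycleCover_succ (by decide) (by decide) ih).1
  | succ m ih =>
    have e : 2 * (k + (m + 1) + 1) = 2 * (k + m + 1) + 2 := by ring
    have e' : 2 ^ (m + 1 + 1) * (2 * (k + m + 1) + 2) =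
      2 * (2 ^ (m + 1) * (2 * (k + m + 1)) + 2 ^ (m + 2)) := by ring
    rw [e, e', show 2 ^ (m + 1 + 2) = 2 ^ (m + 2) * 2 from pow_succ _ _]
    exact (hypercubeGraph_hasBalancedCycleCover_succ
      ((Nat.even_pow.2 ⟨even_two, by omega⟩)) (by positivity) ih).2

/-! ### From covers to decompositions -/

/-- The subgraph traced by a cycle is isomorphic to a cycle graph. -/
theorem SimpleGraph.Walk.IsCycle.nonempty_iso_cycleGraph {V : Type*} {G : SimpleGraph V} {x : V}
    {c : G.Walk x x} (hc : c.IsCycle) :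
    Nonempty (c.toSubgraph.coe ≃g cycleGraph c.length) := by
  have h3 := hc.three_le_length
  have hinj : ∀ i j, i < c.length → j < c.length → c.getVert i = c.getVert j → i = j :=
    fun i j hi hj h => hc.getVert_injOn' (by rw [Set.mem_ofPred_eq]; omega)
      (by rw [Set.mem_ofPred_eq]; omega) h
  let f : Fin c.length → c.toSubgraph.verts := fun i =>
    ⟨c.getVert i, by rw [Walk.mem_verts_toSubgraph]; exact c.getVert_mem_support i⟩
  have hf : Function.Bijective f := by
    constructor
    · intro i j h
      exact Fin.ext (hinj _ _ i.2 j.2 (congrArg Subtype.val h))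
    · rintro ⟨v, hv⟩
      rw [Walk.mem_verts_toSubgraph] at hv
      obtain ⟨i, hi, hil⟩ := Walk.mem_support_iff_exists_getVert.1 hv
      rcases hil.lt_or_eq with h | h
      · exact ⟨⟨i, h⟩, Subtype.ext hi⟩
      · refine ⟨⟨0, by omega⟩, Subtype.ext ?_⟩
        subst h
        change c.getVert 0 = v
        rw [c.getVert_zero, ← hi, c.getVert_length]
  refine ⟨RelIso.symm ⟨Equiv.ofBijective f hf, ?_⟩⟩
  intro i j
  change c.toSubgraph.Adj (c.getVert i) (c.getVert j) ↔ _
  have hmod : ∀ k, k < c.length → c.getVert (k + 1) = c.getVert ((k + 1) % c.length) := by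
    intro k hk
    rcases Nat.lt_or_ge (k + 1) c.length with h | h
    · rw [Nat.mod_eq_of_lt h]
    · have : k + 1 = c.length := by omega
      rw [this, Nat.mod_self, c.getVert_length, c.getVert_zero]
  have hadj : (cycleGraph c.length).Adj i j ↔
      (j : ℕ) = (i + 1) % c.length ∨ (i : ℕ) = (j + 1) % c.length := by
    have key : ∀ a b : Fin c.length, (a - b).val = 1 ↔ (a : ℕ) = (b + 1) % c.length := by
      intro a b
      rw [Fin.sub_def]
      dsimp only
      have ha := a.2
      have hb := b.2
      rcases Nat.lt_or_ge (b + 1) c.length with h | h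
      · rw [Nat.mod_eq_of_lt h]
        rcases Nat.lt_or_ge a b with h' | h'
        · rw [Nat.mod_eq_of_lt (by omega)]; omega
        · rw [Nat.mod_eq_sub_mod (by omega), Nat.mod_eq_of_lt (by omega)]; omega
      · have e : (b : ℕ) + 1 = c.length := by omega
        rw [e, Nat.mod_self]
        rcases Nat.lt_or_ge a b with h' | h'
        · rw [Nat.mod_eq_of_lt (by omega)]; omega
        · rw [Nat.mod_eq_sub_mod (by omega), Nat.mod_eq_of_lt (by omega)]; omega
    rw [cycleGraph_adj', key, key, or_comm]
  rw [hadj, Walk.toSubgraph_adj_iff]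
  have hlt : ∀ k, k % c.length < c.length := fun k => Nat.mod_lt _ (by omega)
  constructor
  · rintro ⟨k, hk, hkl⟩
    rw [hmod k hkl] at hk
    rcases Sym2.eq_iff.1 hk with ⟨h1, h2⟩ | ⟨h1, h2⟩
    · have e1 := hinj _ _ hkl i.2 h1
      have e2 := hinj _ _ (hlt _) j.2 h2
      left; rw [← e2, e1]
    · have e1 := hinj _ _ hkl j.2 h1
      have e2 := hinj _ _ (hlt _) i.2 h2
      right; rw [← e2, e1]
  · rintro (h | h)
    · exact ⟨i, by rw [hmod _ i.2, ← h], i.2⟩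
    · exact ⟨j, by rw [hmod _ j.2, ← h, Sym2.eq_swap], j.2⟩

theorem hypercubeGraph_adj_iff {n : ℕ} {u v : Fin n → Bool} :
    (hypercubeGraph n).Adj u v ↔ ∃ i, Function.update u i (!u i) = v := by
  change (∃! i, u i ≠ v i) ↔ _
  constructor
  · rintro ⟨i, hi, hu⟩
    refine ⟨i, funext fun j => ?_⟩
    rcases eq_or_ne j i with rfl | h
    · simpa [Bool.eq_not] using hi
    · rw [Function.update_of_ne h]
      by_contra h'
      exact h (hu j h')
  · rintro ⟨i, rfl⟩
    refine ⟨i, by simp, fun j hj => ?_⟩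
    by_contra h
    exact hj (Function.update_of_ne h _ _).symm

theorem two_mul_ncard_edgeSet_hypercubeGraph (n : ℕ) :
    2 * (hypercubeGraph n).edgeSet.ncard = n * 2 ^ n := by
  classical
  have hdeg : ∀ v, (hypercubeGraph n).degree v = n := by
    intro v
    have : (hypercubeGraph n).neighborFinset v =
        Finset.univ.image (fun i => Function.update v i (!v i)) := by
      ext w
      simp [hypercubeGraph_adj_iff]
    rw [← card_neighborFinset_eq_degree, this, Finset.card_image_of_injective, Finset.card_univ,
      Fintype.card_fin]
    intro i j hij
    by_contra h
    have := congrFun hij i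
    simp [Function.update_of_ne h] at this
  have := (hypercubeGraph n).sum_degrees_eq_twice_card_edges
  simp only [hdeg, Finset.sum_const, Finset.card_univ, Fintype.card_fun, Fintype.card_fin,
    Fintype.card_bool, smul_eq_mul] at this
  rw [mul_comm n, this, Set.ncard_eq_toFinset_card']
  rfl

/-- There are `2 ^ n / s` cycles, since each owns `s` vertices, so together they have `n * 2 ^ n /
2` edge slots. This is the number of edges, and a surjection between finite sets of equal size is
injective: no edge is covered twice. -/
theorem HasBalancedCycleCover.graphDecomposes {n ℓ s : ℕ}
    (h : HasBalancedCycleCover (hypercubeGraph n) ℓ s) (hℓ : 2 * ℓ = n * s) :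
    GraphDecomposes (cycleGraph ℓ) (hypercubeGraph n) := by
  classical
  obtain ⟨T, hT, hT', x, c, A, hc, -, he, hA⟩ := h
  have hT_card : Fintype.card T * s = 2 ^ n := by
    have := Finset.card_eq_sum_card_fiberwise (f := A) (s := Finset.univ) (t := Finset.univ)
      (fun _ _ => by simp)
    simpa [hA] using this.symm
  let Φ : T × Fin ℓ → (hypercubeGraph n).edgeSet := fun z =>
    ⟨(c z.1).edges[(z.2 : ℕ)]'(by rw [Walk.length_edges, (hc z.1).2]; exact z.2.2),
      (c z.1).edges_subset_edgeSet (List.getElem_mem _)⟩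
  have hmem : ∀ t, ∀ e : (hypercubeGraph n).edgeSet, (e : Sym2 _) ∈ (c t).edges →
      ∃ i, Φ (t, i) = e := by
    rintro t ⟨e, _⟩ h
    obtain ⟨i, hi, hie⟩ := List.getElem_of_mem h
    exact ⟨⟨i, by rwa [Walk.length_edges, (hc t).2] at hi⟩, Subtype.ext hie⟩
  have hsurj : Function.Surjective Φ := by
    intro e
    obtain ⟨t, ht⟩ := he e e.2
    obtain ⟨i, hi⟩ := hmem t e ht
    exact ⟨_, hi⟩
  have hcard : Fintype.card (T × Fin ℓ) = Fintype.card (hypercubeGraph n).edgeSet := by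
    have := two_mul_ncard_edgeSet_hypercubeGraph n
    rw [Fintype.card_prod, Fintype.card_fin]
    apply Nat.eq_of_mul_eq_mul_left two_pos
    rw [← Nat.card_eq_fintype_card (α := (hypercubeGraph n).edgeSet), Nat.card_coe_set_eq, this,
      ← hT_card, mul_left_comm, hℓ]
    ring
  have hinj := ((Fintype.bijective_iff_surjective_and_card Φ).2 ⟨hsurj, hcard⟩).1
  have huniq : ∀ e ∈ (hypercubeGraph n).edgeSet, ∀ t t', e ∈ (c t).edges → e ∈ (c t').edges →
      t = t' := by
    intro e he t t' h h'
    obtain ⟨i, hi⟩ := hmem t ⟨e, he⟩ h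
    obtain ⟨i', hi'⟩ := hmem t' ⟨e, he⟩ h'
    exact congrArg Prod.fst (hinj (hi.trans hi'.symm))
  let φ := (Fintype.equivFin T).symm
  refine ⟨Fintype.card T, fun i => (c (φ i)).toSubgraph, ⟨fun i j hij => ?_, fun e hE => ?_⟩,
    fun i => ?_⟩
  · rw [Set.disjoint_left]
    intro e h h'
    rw [Walk.mem_edges_toSubgraph] at h h'
    exact hij (φ.injective (huniq e ((c (φ i)).edges_subset_edgeSet h) _ _ h h'))
  · obtain ⟨t, ht⟩ := he e hE
    refine ⟨φ.symm t, ?_, fun i hi => ?_⟩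
    · refine (Walk.mem_edges_toSubgraph _).2 ?_
      rwa [φ.apply_symm_apply]
    · replace hi := (Walk.mem_edges_toSubgraph _).1 hi
      rw [φ.eq_symm_apply]
      exact huniq e hE _ _ hi ht
  · have := (hc (φ i)).1.nonempty_iso_cycleGraph
    rwa [(hc (φ i)).2] at this

theorem theorem1p1 (n m : ℕ) (hm : 1 ≤ m) (hn : Even n) (hmn : 2 ^ m ≤ n) :
    GraphDecomposes (SimpleGraph.cycleGraph (2 ^ m * n)) (hypercubeGraph n) := by
  obtain ⟨m, rfl⟩ := Nat.exists_eq_add_of_le' hm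
  obtain ⟨r, rfl⟩ := hn
  have hlt : m < 2 ^ m := Nat.lt_two_pow_self
  -- Since `m` now stands for the original exponent minus one, the hypothesis gives `r ≥ 2 ^ m ≥ m +
  -- 1`; only this linear bound is needed.
  obtain ⟨k, rfl⟩ : ∃ k, r = k + m + 1 := ⟨r - (m + 1), by rw [pow_succ] at hmn; omega⟩
  rw [← two_mul]
  refine (hasBalancedCycleCover_hypercubeGraph m k).graphDecomposes ?_
  ring
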